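/- For an integer $\alpha\ge 0$ let $(p_n^{\alpha})_{n\ge 0}$ be the orthonormal polynomials on $[-1,1]$ with respect to $(1-x^2)^{\alpha}\,dx$: $p_n^\alpha$ is a real polynomial of degree $n$ with positive leading coefficient and $\int_{-1}^1 p_m^{\alpha}(x)p_n^{\alpha}(x)(1-x^2)^{\alpha}\,dx=\delta_{mn}$. For integers $\ell\ge 0$ and $-\ell\le k\le \ell$ let $$Y_\ell^k(\phi,\theta)=\frac{1}{\sqrt{2\pi}}\,e^{ik\theta}(\sin\phi)^{|k|}\,p_{\ell-|k|}^{|k|}(\cos\phi),\qquad (\phi,\theta)\in[0,\pi]\times[0,2\pi),$$ be the spherical harmonics, which are orthonormal with respect to $\sin\phi\,d\phi\,d\theta$. Then there is a universal constant $C>0$ such that for all integers $\ell\ge 0$, all integers $k$ with $-\ell\le k\le\ell$, and all $(\phi,\theta)\in[0,\pi]\times[0,2\pi)$, $$(\sin\phi)^{1/2}\,|Y_\ell^k(\phi,\theta)|\le C\,(\ell+1)^{1/4}.$$ -/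

import Mathlib

open Polynomial

noncomputable section

/-- The inner product of two real polynomials on `[-1, 1]` with respect to `(1 - x²)^α dx`. -/
def jacobiInner (α : ℕ) (p q : ℝ[X]) : ℝ :=
  ∫ x in (-1 : ℝ)..1, p.eval x * q.eval x * (1 - x ^ 2) ^ α

/-- Gram-Schmidt orthogonalization of `1, X, X², …` with respect to `(1 - x²)^α dx` on
`[-1, 1]`: the monic orthogonal polynomials. -/
def monicJacobi (α n : ℕ) : ℝ[X] :=
  X ^ n - ∑ m : Fin n,
    C (jacobiInner α (X ^ n) (monicJacobi α m) /
      jacobiInner α (monicJacobi α m) (monicJacobi α m)) * monicJacobi α m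
termination_by n
decreasing_by exact m.2

/-- The Jacobi polynomial `p_n^α`, orthonormal with respect to `(1 - x²)^α dx` on `[-1, 1]`. -/
def jacobiPoly (α n : ℕ) : ℝ[X] :=
  C (√(jacobiInner α (monicJacobi α n) (monicJacobi α n)))⁻¹ * monicJacobi α n

/-- The `L²`-normalized spherical harmonic
`Y_ℓ^k(φ, θ) = (2π)^(-1/2) e^{ikθ} (sin φ)^|k| p_{ℓ-|k|}^{|k|}(cos φ)`, for `|k| ≤ ℓ`;
`φ` is the polar angle and `θ` the azimuth. -/
def sphericalHarmonic (ℓ : ℕ) (k : ℤ) (φ θ : ℝ) : ℂ :=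
  ((√(2 * Real.pi))⁻¹ : ℝ) * Complex.exp (Complex.I * k * θ) *
    (Real.sin φ ^ k.natAbs * (jacobiPoly k.natAbs (ℓ - k.natAbs)).eval (Real.cos φ) : ℝ)

theorem jacobiInner_comm (α : ℕ) (p q : ℝ[X]) : jacobiInner α p q = jacobiInner α q p := by
  simp only [jacobiInner, mul_comm (p.eval _)]

theorem jacobiInner_sub_left (α : ℕ) (p q r : ℝ[X]) :
    jacobiInner α (p - q) r = jacobiInner α p r - jacobiInner α q r := by
  unfold jacobiInner
  rw [← intervalIntegral.integral_sub]
  · simp [sub_mul]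
  all_goals exact Continuous.intervalIntegrable (by fun_prop) _ _

theorem jacobiInner_C_mul_left (α : ℕ) (c : ℝ) (p r : ℝ[X]) :
    jacobiInner α (C c * p) r = c * jacobiInner α p r := by
  unfold jacobiInner
  rw [← intervalIntegral.integral_const_mul]
  simp [mul_assoc]

theorem jacobiInner_sum_left (α : ℕ) {ι : Type*} (s : Finset ι) (p : ι → ℝ[X]) (r : ℝ[X]) :
    jacobiInner α (∑ i ∈ s, p i) r = ∑ i ∈ s, jacobiInner α (p i) r := by
  unfold jacobiInner
  rw [← intervalIntegral.integral_finsetSum]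
  · simp [eval_finsetSum, Finset.sum_mul]
  · intro i _
    exact Continuous.intervalIntegrable (by fun_prop) _ _

theorem jacobiInner_self_pos (α : ℕ) {p : ℝ[X]} (hp : p ≠ 0) : 0 < jacobiInner α p p := by
  have hq : p * (1 - X ^ 2) ≠ 0 := by
    refine mul_ne_zero hp fun h => ?_
    have := congrArg (eval 0) h
    simp at this
  obtain ⟨c, hc, hc0⟩ : ∃ c ∈ Set.Ioo (-1 : ℝ) 1, (p * (1 - X ^ 2)).eval c ≠ 0 := by
    by_contra! h
    exact hq (eq_zero_of_infinite_isRoot _ ((Set.Ioo_infinite (by norm_num)).mono h))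
  refine intervalIntegral.integral_pos (by norm_num) (by fun_prop) ?_
    ⟨c, Set.Ioo_subset_Icc_self hc, ?_⟩
  · intro x hx
    have : 0 ≤ 1 - x ^ 2 := by nlinarith [hx.1, hx.2]
    exact mul_nonneg (mul_self_nonneg _) (pow_nonneg this _)
  · have h1 : 0 < 1 - c ^ 2 := by nlinarith [hc.1, hc.2]
    have h2 : p.eval c ≠ 0 := fun h => hc0 (by simp [h])
    exact mul_pos (mul_self_pos.2 h2) (pow_pos h1 _)

theorem monicJacobi_natDegree_monic (α n : ℕ) :
    (monicJacobi α n).natDegree = n ∧ (monicJacobi α n).Monic := by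
  induction n using Nat.strong_induction_on with
  | _ n ih =>
    have hlt : (∑ m : Fin n,
        C (jacobiInner α (X ^ n) (monicJacobi α m) /
          jacobiInner α (monicJacobi α m) (monicJacobi α m)) * monicJacobi α m).degree
        < (n : WithBot ℕ) := by
      refine (degree_sum_le _ _).trans_lt ((Finset.sup_lt_iff (WithBot.bot_lt_coe n)).2 ?_)
      intro m _
      refine degree_le_natDegree.trans_lt ?_
      have h1 := (natDegree_C_mul_le (jacobiInner α (X ^ n) (monicJacobi α m) /
          jacobiInner α (monicJacobi α m) (monicJacobi α m)) (monicJacobi α m)).trans_lt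
        (by rw [(ih m m.2).1]; exact m.2)
      exact WithBot.coe_lt_coe.2 h1
    rw [monicJacobi]
    refine ⟨natDegree_eq_of_degree_eq_some ?_, (monic_X_pow n).sub_of_left (by simpa using hlt)⟩
    rw [degree_sub_eq_left_of_degree_lt (by simpa using hlt), degree_X_pow]

theorem monicJacobi_ne_zero (α n : ℕ) : monicJacobi α n ≠ 0 :=
  (monicJacobi_natDegree_monic α n).2.ne_zero

theorem monicJacobi_orthogonal (α : ℕ) {n j : ℕ} (h : j < n) :
    jacobiInner α (monicJacobi α n) (monicJacobi α j) = 0 := by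
  induction n using Nat.strong_induction_on generalizing j with
  | _ n ih =>
    rw [monicJacobi, jacobiInner_sub_left, jacobiInner_sum_left,
      Finset.sum_eq_single (⟨j, h⟩ : Fin n)]
    · have := (jacobiInner_self_pos α (monicJacobi_ne_zero α j)).ne'
      simp only [jacobiInner_C_mul_left]
      field_simp
      ring
    · intro m _ hm
      rw [jacobiInner_C_mul_left]
      have hne : (m : ℕ) ≠ j := fun e => hm (Fin.ext e)
      rcases lt_or_gt_of_ne hne with h1 | h1
      · rw [jacobiInner_comm α (monicJacobi α m) (monicJacobi α j), ih j h h1, mul_zero]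
      · rw [ih m m.2 h1, mul_zero]
    · simp

/-- `p_n^α` has exact degree `n`. -/
theorem jacobiPoly_natDegree (α n : ℕ) : (jacobiPoly α n).natDegree = n := by
  have := jacobiInner_self_pos α (monicJacobi_ne_zero α n)
  rw [jacobiPoly, natDegree_C_mul (inv_ne_zero (Real.sqrt_pos.2 this).ne'),
    (monicJacobi_natDegree_monic α n).1]

theorem jacobiPoly_leadingCoeff_pos (α n : ℕ) : 0 < (jacobiPoly α n).leadingCoeff := by
  have := jacobiInner_self_pos α (monicJacobi_ne_zero α n)
  rw [jacobiPoly, leadingCoeff_mul, leadingCoeff_C,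
    (monicJacobi_natDegree_monic α n).2.leadingCoeff, mul_one]
  exact inv_pos.2 (Real.sqrt_pos.2 this)

/-- The polynomials `p_n^α` are orthonormal with respect to `(1 - x²)^α dx` on `[-1, 1]`. -/
theorem jacobiPoly_orthonormal (α m n : ℕ) :
    ∫ x in (-1 : ℝ)..1, (jacobiPoly α m).eval x * (jacobiPoly α n).eval x * (1 - x ^ 2) ^ α
      = if m = n then 1 else 0 := by
  change jacobiInner α (jacobiPoly α m) (jacobiPoly α n) = _
  rw [jacobiPoly, jacobiPoly, jacobiInner_C_mul_left, jacobiInner_comm α (monicJacobi α m) (C _ * _),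
    jacobiInner_C_mul_left]
  split_ifs with h
  · subst h
    have := jacobiInner_self_pos α (monicJacobi_ne_zero α m)
    rw [← mul_assoc, ← mul_inv, Real.mul_self_sqrt this.le, inv_mul_cancel₀ this.ne']
  · rcases lt_or_gt_of_ne h with h1 | h1
    · rw [monicJacobi_orthogonal α h1]; simp
    · rw [jacobiInner_comm α (monicJacobi α n) (monicJacobi α m), monicJacobi_orthogonal α h1]; simp

end

/-! With `n = ℓ - |k|` and `α = |k|`, put `u(φ) = (sin φ)^(α+1/2) p_n^α(cos φ)`. Up to the factor
`1/√(2π)`, `|u|` is the quantity to be bounded. Jacobi's equation becomes `u'' = -q u` with `q = Q -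
μ cot²`, where `L = ℓ + 1/2`, `μ = α² - 1/4`, `Q = L² - μ`, and orthonormality becomes `∫ u² = 1`.
It remains to show that `M = max u²` is `O(√L)`, uniformly in `α`. By reflection the maximum point
`c` may be taken in `(0, π/2]`.

For `α ≥ 1` the potential increases on `(0, π/2]`, and there are two regimes. If `q(c) ≤ L`, then `q
≤ L` to the left of `c`, so `u²` stays above `M/2` on an interval of length about `L^(-1/2)`, and
unit mass gives `M ≤ 4√L` (`max_sq_le_sqrt`). If `q(c) ≥ L`, a corrected WKB energy carries the size
of `u` from `c` to a window of length `w = √Q/(8L)` next to the equator, where `q` is comparable to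
`Q` (`wkb_energy_ge`). There the energy `u'² + Q u²` is at least of order `√Q √L M`, and an energy
bound `K` on such a window costs `K w ≲ Q` of mass (`energy_le_integral_sq`); again `M ≲ √L`. When
`c` is itself near the equator, Sonin's function replaces the WKB energy.

For `α = 0` the potential decreases on `(0, π/2]`, and monotone energies alone give a bounded `M`.
-/

/-! ### Solutions of `u'' = -q u` -/

section ODE

variable {u v q : ℝ → ℝ}

/-- On an interval where the energy `u'² + Q u²` is at least `K`, the `L²` mass of `u` is
bounded below in terms of `K`. -/
theorem energy_le_integral_sq {a b Q K : ℝ} (hab : a ≤ b) (hQ : 0 ≤ Q)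
    (hu : ∀ x ∈ Set.Icc a b, HasDerivAt u (v x) x)
    (hv : ∀ x ∈ Set.Icc a b, HasDerivAt v (-q x * u x) x)
    (hqc : ContinuousOn q (Set.Icc a b)) (hq : ∀ x ∈ Set.Icc a b, q x ≤ Q)
    (hK : ∀ x ∈ Set.Icc a b, K ≤ v x ^ 2 + Q * u x ^ 2) :
    K * (b - a) ^ 5 / 30 ≤
      ((b - a) ^ 2 + Q * (b - a) ^ 4 / 8) * ∫ x in a..b, u x ^ 2 := by
  set w := b - a with hw
  have huc : ContinuousOn u (Set.Icc a b) := fun x hx => (hu x hx).continuousAt.continuousWithinAt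
  have hvc : ContinuousOn v (Set.Icc a b) := fun x hx => (hv x hx).continuousAt.continuousWithinAt
  -- The weight `g` vanishes to second order at both ends, so testing the equation with `g u` leaves
  -- no boundary terms. `p` is a primitive of `g`, with total increment `w⁵/30`.
  let g : ℝ → ℝ := fun x => (x - a) ^ 2 * (b - x) ^ 2
  let g1 : ℝ → ℝ := fun x => 2 * (x - a) * (b - x) ^ 2 - 2 * (x - a) ^ 2 * (b - x)
  let g2 : ℝ → ℝ := fun x => 2 * (b - x) ^ 2 - 8 * (x - a) * (b - x) + 2 * (x - a) ^ 2
  let p : ℝ → ℝ := fun x => w ^ 2 * (x - a) ^ 3 / 3 - w * (x - a) ^ 4 / 2 + (x - a) ^ 5 / 5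
  have hA : ∀ x, HasDerivAt (fun y : ℝ => y - a) 1 x := fun x => (hasDerivAt_id x).sub_const a
  have hB : ∀ x, HasDerivAt (fun y : ℝ => b - y) (-1) x := fun x => (hasDerivAt_id x).const_sub b
  have hg : ∀ x, HasDerivAt g (g1 x) x := fun x => by
    refine HasDerivAt.congr_deriv (((hA x).pow 2).mul ((hB x).pow 2)) ?_
    simp [g1]; ring
  have hg1 : ∀ x, HasDerivAt g1 (g2 x) x := fun x => by
    refine HasDerivAt.congr_deriv ((((hA x).const_mul 2).mul ((hB x).pow 2)).sub
      ((((hA x).pow 2).const_mul 2).mul (hB x))) ?_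
    simp [g2]; ring
  have hp : ∀ x, HasDerivAt p (g x) x := fun x => by
    refine HasDerivAt.congr_deriv ((((((hA x).pow 3).const_mul (w ^ 2)).div_const 3).sub
      ((((hA x).pow 4).const_mul w).div_const 2)).add (((hA x).pow 5).div_const 5)) ?_
    simp [g, hw]; ring
  let D : ℝ → ℝ := fun x => g x * v x ^ 2 - (g x * q x + g2 x / 2) * u x ^ 2 - K * g x
  have hD : ∀ x ∈ Set.uIcc a b, HasDerivAt
      (fun x => g x * (u x * v x) - g1 x * u x ^ 2 / 2 - K * p x) (D x) x := by
    intro x hx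
    rw [Set.uIcc_of_le hab] at hx
    refine HasDerivAt.congr_deriv ((((hg x).mul ((hu x hx).mul (hv x hx))).sub
      (((hg1 x).mul ((hu x hx).pow 2)).div_const 2)).sub ((hp x).const_mul K)) ?_
    simp [D]; ring
  have hgc : Continuous g := by fun_prop
  have hg2c : Continuous g2 := by fun_prop
  have hDc : ContinuousOn D (Set.Icc a b) := by fun_prop
  have hI := intervalIntegral.integral_eq_sub_of_hasDerivAt hD
    (by rw [← Set.uIcc_of_le hab] at hDc; exact hDc.intervalIntegrable)
  have hval : (∫ x in a..b, D x) = - (K * w ^ 5 / 30) := by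
    rw [hI]; simp [g, g1, p, ← hw]; ring
  have hmono : (∫ x in a..b, -(w ^ 2 + Q * w ^ 4 / 8) * u x ^ 2) ≤ ∫ x in a..b, D x := by
    refine intervalIntegral.integral_mono_on hab ?_ ?_ ?_
    · exact ContinuousOn.intervalIntegrable (by rw [Set.uIcc_of_le hab]; fun_prop)
    · exact ContinuousOn.intervalIntegrable (by rw [Set.uIcc_of_le hab]; exact hDc)
    · intro x hx
      have h0 : 0 ≤ (x - a) * (b - x) := mul_nonneg (by linarith [hx.1]) (by linarith [hx.2])
      have hgn : 0 ≤ g x := by positivity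
      have hgle : g x ≤ w ^ 4 / 16 := by
        have : (x - a) * (b - x) ≤ w ^ 2 / 4 := by
          rw [hw]; nlinarith [sq_nonneg ((x - a) - (b - x))]
        calc g x = ((x - a) * (b - x)) ^ 2 := by simp [g]; ring
          _ ≤ (w ^ 2 / 4) ^ 2 := by gcongr
          _ = _ := by ring
      have hg2le : g2 x / 2 ≤ w ^ 2 := by simp only [g2, hw]; nlinarith
      have h1 := mul_le_mul_of_nonneg_left (hK x hx) hgn
      have h2 : (g x * q x + g2 x / 2 + Q * g x) * u x ^ 2 ≤
          (w ^ 2 + Q * w ^ 4 / 8) * u x ^ 2 := by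
        refine mul_le_mul_of_nonneg_right ?_ (sq_nonneg _)
        have := mul_le_mul_of_nonneg_left (hq x hx) hgn
        have := mul_le_mul_of_nonneg_left hgle hQ
        linarith
      simp only [D]; linarith
  rw [hval, intervalIntegral.integral_const_mul] at hmono
  linarith

/-- Sonin's function `u² + u'²/q` decreases where `q` increases. -/
theorem sonin_le_of_deriv_nonneg {q1 : ℝ → ℝ} {a b : ℝ} (hab : a ≤ b)
    (hu : ∀ x ∈ Set.Icc a b, HasDerivAt u (v x) x)
    (hv : ∀ x ∈ Set.Icc a b, HasDerivAt v (-q x * u x) x)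
    (hq : ∀ x ∈ Set.Icc a b, HasDerivAt q (q1 x) x) (hpos : ∀ x ∈ Set.Icc a b, 0 < q x)
    (hq1 : ∀ x ∈ Set.Icc a b, 0 ≤ q1 x) :
    u b ^ 2 + v b ^ 2 / q b ≤ u a ^ 2 + v a ^ 2 / q a := by
  have hd : ∀ x ∈ Set.Icc a b,
      HasDerivAt (fun x => u x ^ 2 + v x ^ 2 / q x) (-(q1 x * v x ^ 2 / q x ^ 2)) x := by
    intro x hx
    have h0 := (hpos x hx).ne'
    refine HasDerivAt.congr_deriv (((hu x hx).pow 2).add (((hv x hx).pow 2).div (hq x hx) h0)) ?_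
    simp; field_simp; ring
  refine antitoneOn_of_hasDerivWithinAt_nonpos (convex_Icc a b)
    (fun x hx => (hd x hx).continuousAt.continuousWithinAt)
    (fun x hx => (hd x (interior_subset hx)).hasDerivWithinAt) (fun x hx => ?_)
    (Set.left_mem_Icc.2 hab) (Set.right_mem_Icc.2 hab) hab
  have := hq1 x (interior_subset hx)
  exact neg_nonpos.2 (by positivity)

/-- Sonin's function `u² + u'²/q` increases where `q` decreases. -/
theorem sonin_le_of_deriv_nonpos {q1 : ℝ → ℝ} {a b : ℝ} (hab : a ≤ b)
    (hu : ∀ x ∈ Set.Icc a b, HasDerivAt u (v x) x)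
    (hv : ∀ x ∈ Set.Icc a b, HasDerivAt v (-q x * u x) x)
    (hq : ∀ x ∈ Set.Icc a b, HasDerivAt q (q1 x) x) (hpos : ∀ x ∈ Set.Icc a b, 0 < q x)
    (hq1 : ∀ x ∈ Set.Icc a b, q1 x ≤ 0) :
    u a ^ 2 + v a ^ 2 / q a ≤ u b ^ 2 + v b ^ 2 / q b := by
  have hd : ∀ x ∈ Set.Icc a b,
      HasDerivAt (fun x => u x ^ 2 + v x ^ 2 / q x) (-q1 x * v x ^ 2 / q x ^ 2) x := by
    intro x hx
    have h0 := (hpos x hx).ne'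
    refine HasDerivAt.congr_deriv (((hu x hx).pow 2).add (((hv x hx).pow 2).div (hq x hx) h0)) ?_
    simp; field_simp; ring
  refine monotoneOn_of_hasDerivWithinAt_nonneg (convex_Icc a b)
    (fun x hx => (hd x hx).continuousAt.continuousWithinAt)
    (fun x hx => (hd x (interior_subset hx)).hasDerivWithinAt) (fun x hx => ?_)
    (Set.left_mem_Icc.2 hab) (Set.right_mem_Icc.2 hab) hab
  have := neg_nonneg.2 (hq1 x (interior_subset hx))
  positivity

/-- The energy `u'² + q u²` decreases where `q` decreases. -/
theorem energy_le_of_deriv_nonpos {q1 : ℝ → ℝ} {a b : ℝ} (hab : a ≤ b)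
    (hu : ∀ x ∈ Set.Icc a b, HasDerivAt u (v x) x)
    (hv : ∀ x ∈ Set.Icc a b, HasDerivAt v (-q x * u x) x)
    (hq : ∀ x ∈ Set.Icc a b, HasDerivAt q (q1 x) x)
    (hq1 : ∀ x ∈ Set.Icc a b, q1 x ≤ 0) :
    v b ^ 2 + q b * u b ^ 2 ≤ v a ^ 2 + q a * u a ^ 2 := by
  have hd : ∀ x ∈ Set.Icc a b,
      HasDerivAt (fun x => v x ^ 2 + q x * u x ^ 2) (q1 x * u x ^ 2) x := by
    intro x hx
    refine HasDerivAt.congr_deriv (((hv x hx).pow 2).add ((hq x hx).mul ((hu x hx).pow 2))) ?_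
    simp; ring
  refine antitoneOn_of_hasDerivWithinAt_nonpos (convex_Icc a b)
    (fun x hx => (hd x hx).continuousAt.continuousWithinAt)
    (fun x hx => (hd x (interior_subset hx)).hasDerivWithinAt) (fun x hx => ?_)
    (Set.left_mem_Icc.2 hab) (Set.right_mem_Icc.2 hab) hab
  exact mul_nonpos_of_nonpos_of_nonneg (hq1 x (interior_subset hx)) (sq_nonneg _)

/-- A WKB energy bound: if `h = q^(-1/2)` up to a constant factor, with `h'' ≥ 0 ≥ h'''`, then to
the right of a maximum of `u²` the modified energy `h (u'² + q u²) - h' u u'` is at least its value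
at the maximum. -/
theorem wkb_energy_ge {h h1 h2 h3 q1 : ℝ → ℝ} {a b M : ℝ} (hab : a ≤ b)
    (hu : ∀ x ∈ Set.Icc a b, HasDerivAt u (v x) x)
    (hv : ∀ x ∈ Set.Icc a b, HasDerivAt v (-q x * u x) x)
    (hq : ∀ x ∈ Set.Icc a b, HasDerivAt q (q1 x) x)
    (hh : ∀ x ∈ Set.Icc a b, HasDerivAt h (h1 x) x)
    (hh1 : ∀ x ∈ Set.Icc a b, HasDerivAt h1 (h2 x) x)
    (hh2 : ∀ x ∈ Set.Icc a b, HasDerivAt h2 (h3 x) x)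
    (hhq : ∀ x ∈ Set.Icc a b, 2 * h1 x * q x + h x * q1 x = 0)
    (h3n : ∀ x ∈ Set.Icc a b, h3 x ≤ 0) (h2n : 0 ≤ h2 b)
    (hM : ∀ x ∈ Set.Icc a b, u x ^ 2 ≤ M) (hua : u a ^ 2 = M) (hva : v a = 0) :
    h a * q a * M ≤ h b * (v b ^ 2 + q b * u b ^ 2) - h1 b * (u b * v b) := by
  -- The derivative of `h (u'² + q u²) - h' u u'` is `-h'' u u'`. Adding `h'' u²/2` would cancel it
  -- but leave `h''' u²/2 ≤ 0`; using `u² - M` in place of `u²` reverses the sign.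
  have hd : ∀ x ∈ Set.Icc a b, HasDerivAt
      (fun x => h x * (v x ^ 2 + q x * u x ^ 2) - h1 x * (u x * v x) - h2 x * (M - u x ^ 2) / 2)
      (-h3 x * (M - u x ^ 2) / 2) x := by
    intro x hx
    refine HasDerivAt.congr_deriv ((((hh x hx).mul (((hv x hx).pow 2).add ((hq x hx).mul ((hu x hx).pow 2)))).sub
      ((hh1 x hx).mul ((hu x hx).mul (hv x hx)))).sub
      (((hh2 x hx).mul (((hu x hx).pow 2).const_sub M)).div_const 2)) ?_
    simp
    linear_combination (u x ^ 2) * hhq x hx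
  have key := monotoneOn_of_hasDerivWithinAt_nonneg (convex_Icc a b)
    (fun x hx => (hd x hx).continuousAt.continuousWithinAt)
    (fun x hx => (hd x (interior_subset hx)).hasDerivWithinAt) (fun x hx => by
      have h1 := neg_nonneg.2 (h3n x (interior_subset hx))
      have h2 := sub_nonneg.2 (hM x (interior_subset hx))
      positivity)
    (Set.left_mem_Icc.2 hab) (Set.right_mem_Icc.2 hab) hab
  simp only [hua, hva] at key
  have := mul_nonneg h2n (sub_nonneg.2 (hM b (Set.right_mem_Icc.2 hab)))
  linarith

/-- To the left of a maximum point `c` of `u²`, if `q ≤ A` then `u²` decays at most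
quadratically. -/
theorem sq_ge_of_max {a c A M : ℝ} (hac : a ≤ c) (hA : 0 ≤ A)
    (hu : ∀ x ∈ Set.Icc a c, HasDerivAt u (v x) x)
    (hv : ∀ x ∈ Set.Icc a c, HasDerivAt v (-q x * u x) x)
    (hq : ∀ x ∈ Set.Icc a c, q x ≤ A)
    (hM : ∀ x ∈ Set.Icc a c, u x ^ 2 ≤ M) (huc : u c ^ 2 = M) (hvc : v c = 0) :
    M * (1 - A * (c - a) ^ 2) ≤ u a ^ 2 := by
  have hC : ∀ x, HasDerivAt (fun y : ℝ => c - y) (-1) x := fun x => (hasDerivAt_id x).const_sub c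
  -- This is `(u²)'' ≥ -2AM`, to be integrated twice from `c`, where `(u²)' = 0`.
  have hd1 : ∀ x ∈ Set.Icc a c, HasDerivAt (fun x => 2 * (u x * v x) - 2 * A * M * (c - x))
      (2 * (v x ^ 2 - q x * u x ^ 2) + 2 * A * M) x := by
    intro x hx
    refine HasDerivAt.congr_deriv ((((hu x hx).mul (hv x hx)).const_mul 2).sub ((hC x).const_mul (2 * A * M))) ?_
    ring
  have hmono := monotoneOn_of_hasDerivWithinAt_nonneg (convex_Icc a c)
    (fun x hx => (hd1 x hx).continuousAt.continuousWithinAt)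
    (fun x hx => (hd1 x (interior_subset hx)).hasDerivWithinAt) (fun x hx => by
      have hx := interior_subset hx
      have h1 := mul_le_mul_of_nonneg_right (hq x hx) (sq_nonneg (u x))
      have h2 := mul_le_mul_of_nonneg_left (hM x hx) hA
      nlinarith [sq_nonneg (v x)])
  have hd2 : ∀ x ∈ Set.Icc a c, HasDerivAt (fun x => u x ^ 2 + A * M * (c - x) ^ 2)
      (2 * (u x * v x) - 2 * A * M * (c - x)) x := by
    intro x hx
    refine HasDerivAt.congr_deriv (((hu x hx).pow 2).add (((hC x).pow 2).const_mul (A * M))) ?_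
    simp; ring
  have hanti := antitoneOn_of_hasDerivWithinAt_nonpos (convex_Icc a c)
    (fun x hx => (hd2 x hx).continuousAt.continuousWithinAt)
    (fun x hx => (hd2 x (interior_subset hx)).hasDerivWithinAt) (fun x hx => by
      have hx := interior_subset hx
      have := hmono hx (Set.right_mem_Icc.2 hac) hx.2
      simpa [hvc] using this)
    (Set.left_mem_Icc.2 hac) (Set.right_mem_Icc.2 hac) hac
  simp only [huc] at hanti
  nlinarith

/-- If `u` vanishes at `0` and `q ≤ A` to the left of a maximum point of `u²`, then the maximum is
at most a multiple of `√A` times the `L²` mass of `u`. -/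
theorem max_sq_le_sqrt {c A M : ℝ} (hc : 0 < c) (hA : 0 ≤ A)
    (hcont : ContinuousOn u (Set.Icc 0 c)) (hu0 : u 0 = 0)
    (hu : ∀ x ∈ Set.Ioc 0 c, HasDerivAt u (v x) x)
    (hv : ∀ x ∈ Set.Ioc 0 c, HasDerivAt v (-q x * u x) x)
    (hq : ∀ x ∈ Set.Ioc 0 c, q x ≤ A)
    (hM : ∀ x ∈ Set.Ioc 0 c, u x ^ 2 ≤ M) (huc : u c ^ 2 = M) (hvc : v c = 0)
    (hint : ∫ x in (0 : ℝ)..c, u x ^ 2 ≤ 1) :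
    M ≤ 4 * √A := by
  have hge : ∀ a ∈ Set.Ioc 0 c, M * (1 - A * (c - a) ^ 2) ≤ u a ^ 2 := fun a ha => by
    have hsub : ∀ x ∈ Set.Icc a c, x ∈ Set.Ioc 0 c := fun x hx => ⟨ha.1.trans_le hx.1, hx.2⟩
    exact sq_ge_of_max ha.2 hA (fun x hx => hu x (hsub x hx)) (fun x hx => hv x (hsub x hx))
      (fun x hx => hq x (hsub x hx)) (fun x hx => hM x (hsub x hx)) huc hvc
  have hM0 : 0 ≤ M := huc ▸ sq_nonneg _
  rcases hM0.eq_or_lt with h0 | hMpos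
  · rw [← h0]; positivity
  -- Letting `a → 0`, the condition `u 0 = 0` forces `A c² ≥ 1`, so an interval of length `δ =
  -- 1/(2√A)` fits between `0` and `c`.
  have hge0 : M * (1 - A * (c - 0) ^ 2) ≤ u 0 ^ 2 := by
    have h1 : Filter.Tendsto (fun a => u a ^ 2) (nhdsWithin 0 (Set.Ioc 0 c)) (nhds (u 0 ^ 2)) :=
      ((hcont 0 ⟨le_rfl, hc.le⟩).mono Set.Ioc_subset_Icc_self).pow 2
    have h2 : Filter.Tendsto (fun a => M * (1 - A * (c - a) ^ 2)) (nhdsWithin 0 (Set.Ioc 0 c))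
        (nhds (M * (1 - A * (c - 0) ^ 2))) :=
      (Continuous.tendsto (by fun_prop) 0).mono_left nhdsWithin_le_nhds
    have : (nhdsWithin (0 : ℝ) (Set.Ioc 0 c)).NeBot := by
      rw [nhdsWithin_Ioc_eq_nhdsGT hc]; infer_instance
    exact le_of_tendsto_of_tendsto h2 h1 (eventually_nhdsWithin_of_forall hge)
  rw [hu0] at hge0
  have hAc : 1 ≤ A * c ^ 2 := by
    by_contra! hlt
    have := mul_pos hMpos (sub_pos.2 hlt)
    simp at hge0; linarith
  have hApos : 0 < A := by
    rcases hA.eq_or_lt with h | h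
    · rw [← h] at hAc; norm_num at hAc
    · exact h
  set r := √A with hr
  have hrpos : 0 < r := Real.sqrt_pos.2 hApos
  have hrA : r ^ 2 = A := Real.sq_sqrt hA
  set δ := 1 / (2 * r) with hδ
  have hδpos : 0 < δ := by positivity
  have hδr : δ * r = 1 / 2 := by rw [hδ]; field_simp
  have hrc : 1 ≤ r * c := by
    by_contra! hlt
    nlinarith [mul_pos hrpos hc]
  have hδc : δ < c := by
    by_contra! hle
    nlinarith
  have hI1 : (∫ x in (c - δ)..c, u x ^ 2) ≤ 1 := by
    refine le_trans ?_ hint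
    refine intervalIntegral.integral_mono_interval (by linarith) (by linarith) le_rfl
      (Filter.Eventually.of_forall fun x => sq_nonneg _) ?_
    exact ContinuousOn.intervalIntegrable (by rw [Set.uIcc_of_le hc.le]; exact hcont.pow 2)
  have hI2 : (∫ x in (c - δ)..c, M / 2) ≤ ∫ x in (c - δ)..c, u x ^ 2 := by
    refine intervalIntegral.integral_mono_on (by linarith) (by simp) ?_ fun x hx => ?_
    · refine ContinuousOn.intervalIntegrable ?_
      rw [Set.uIcc_of_le (by linarith)]
      exact (hcont.mono (Set.Icc_subset_Icc (by linarith) le_rfl)).pow 2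
    · refine le_trans ?_ (hge x ⟨by linarith [hx.1], hx.2⟩)
      have h1 : (c - x) * r ≤ 1 / 2 := by
        rw [← hδr]; exact mul_le_mul_of_nonneg_right (by linarith [hx.1]) hrpos.le
      have h2 : 0 ≤ (c - x) * r := mul_nonneg (by linarith [hx.2]) hrpos.le
      have h3 : A * (c - x) ^ 2 ≤ 1 / 2 := by rw [← hrA]; nlinarith
      nlinarith
  simp at hI2
  have : δ * (M / 2) ≤ 1 := by linarith
  have h4 : δ * (M / 2) * r ≤ 1 * r := mul_le_mul_of_nonneg_right this hrpos.le
  have h5 : δ * (M / 2) * r = M / 4 := by linear_combination M / 2 * hδr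
  linarith

end ODE

/-! ### The potential `Q - μ cot²` -/

section SphericalPotential

open Real Set

/-- The potential `q` of the equation `u'' = -q u` satisfied by
`u(φ) = (sin φ)^(m+1/2) p(cos φ)`, with `Q = (ℓ + 1/2)² - μ` and `μ = m² - 1/4`. -/
noncomputable def sphericalPotential (Q μ φ : ℝ) : ℝ := Q - μ * (cos φ / sin φ) ^ 2

theorem hasDerivAt_cos_div_sin {φ : ℝ} (h : sin φ ≠ 0) :
    HasDerivAt (fun φ => cos φ / sin φ) (-(1 + (cos φ / sin φ) ^ 2)) φ := by
  refine HasDerivAt.congr_deriv ((hasDerivAt_cos φ).div (hasDerivAt_sin φ) h) ?_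
  field_simp
  ring

theorem hasDerivAt_sphericalPotential (Q μ : ℝ) {φ : ℝ} (h : sin φ ≠ 0) :
    HasDerivAt (sphericalPotential Q μ)
      (2 * μ * ((cos φ / sin φ) * (1 + (cos φ / sin φ) ^ 2))) φ := by
  refine HasDerivAt.congr_deriv ((((hasDerivAt_cos_div_sin h).pow 2).const_mul μ).const_sub Q) ?_
  simp; ring

theorem cos_div_sin_nonneg {φ : ℝ} (h0 : 0 ≤ φ) (h1 : φ ≤ π / 2) : 0 ≤ cos φ / sin φ :=
  div_nonneg (cos_nonneg_of_neg_pi_div_two_le_of_le (by linarith [pi_pos]) h1)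
    (sin_nonneg_of_nonneg_of_le_pi h0 (by linarith))

theorem cos_div_sin_le {φ w : ℝ} (hw1 : w ≤ 1) (h0 : π / 2 - w ≤ φ) (h1 : φ ≤ π / 2) :
    cos φ / sin φ ≤ 2 * w := by
  obtain ⟨x, rfl⟩ : ∃ x, φ = π / 2 - x := ⟨π / 2 - φ, by ring⟩
  have hx0 : 0 ≤ x := by linarith
  have hxw : x ≤ w := by linarith
  rw [cos_pi_div_two_sub, sin_pi_div_two_sub]
  have h2 := one_sub_sq_div_two_le_cos (x := x)
  have h3 : 1 / 2 ≤ cos x := by nlinarith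
  rw [div_le_iff₀ (by linarith)]
  have := sin_le hx0
  nlinarith

theorem sphericalPotential_le {Q μ φ : ℝ} (hμ : 0 ≤ μ) : sphericalPotential Q μ φ ≤ Q := by
  have := mul_nonneg hμ (sq_nonneg (cos φ / sin φ))
  simp only [sphericalPotential]; linarith

theorem sphericalPotential_mono {Q μ a b : ℝ} (hμ : 0 ≤ μ) (ha : 0 < a) (hab : a ≤ b)
    (hb : b ≤ π / 2) : sphericalPotential Q μ a ≤ sphericalPotential Q μ b := by
  have h1 : cos b / sin b ≤ cos a / sin a := by
    refine div_le_div₀ (cos_nonneg_of_neg_pi_div_two_le_of_le (by linarith [pi_pos]) (by linarith))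
      (cos_le_cos_of_nonneg_of_le_pi ha.le (by linarith [pi_pos]) hab)
      (sin_pos_of_pos_of_lt_pi ha (by linarith [pi_pos]))
      (sin_le_sin_of_le_of_le_pi_div_two (by linarith [pi_pos]) hb hab)
  have h2 := cos_div_sin_nonneg (ha.le.trans hab) hb
  have h3 := mul_le_mul_of_nonneg_left (pow_le_pow_left₀ h2 h1 2) hμ
  simp only [sphericalPotential]; linarith

theorem sphericalPotential_continuousOn (Q μ : ℝ) {a b : ℝ} (ha : 0 < a) (hb : b < π) :
    ContinuousOn (sphericalPotential Q μ) (Icc a b) := fun _ hx =>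
  (hasDerivAt_sphericalPotential Q μ
    (sin_pos_of_pos_of_lt_pi (ha.trans_le hx.1) (hx.2.trans_lt hb)).ne').continuousAt.continuousWithinAt

/-! ### Maximum of a solution of unit mass -/

variable {u v : ℝ → ℝ} {Q μ L c M : ℝ}

/-- Energy lower bounds on a short interval left of `π/2`. -/
theorem energy_bound_window {a b K w : ℝ} (hμ : 0 ≤ μ) (hw : 0 < w)
    (hQw : 1 ≤ 64 * (Q * w ^ 2)) (ha : 0 < a) (hb : b ≤ π / 2) (hab : b - a = w)
    (hu : ∀ x ∈ Ioo 0 π, HasDerivAt u (v x) x)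
    (hv : ∀ x ∈ Ioo 0 π, HasDerivAt v (-sphericalPotential Q μ x * u x) x)
    (hcont : ContinuousOn u (Icc 0 π)) (hint : ∫ x in (0 : ℝ)..π, u x ^ 2 ≤ 1)
    (hK : ∀ x ∈ Icc a b, K ≤ v x ^ 2 + Q * u x ^ 2) :
    K * w ≤ 1950 * Q := by
  have hpi := pi_pos
  have hsub : ∀ x ∈ Icc a b, x ∈ Ioo 0 π := fun x hx =>
    ⟨ha.trans_le hx.1, by linarith [hx.2]⟩
  have hQ : 0 ≤ Q := by
    by_contra! h
    nlinarith [mul_pos_of_neg_of_neg h (neg_neg_of_pos (pow_pos hw 2))]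
  have h1 := energy_le_integral_sq (K := K) (by linarith) hQ (fun x hx => hu x (hsub x hx))
    (fun x hx => hv x (hsub x hx)) (sphericalPotential_continuousOn Q μ ha (by linarith))
    (fun x _ => sphericalPotential_le hμ) hK
  have hI : (∫ x in a..b, u x ^ 2) ≤ 1 := by
    refine le_trans ?_ hint
    refine intervalIntegral.integral_mono_interval ha.le (by linarith) (by linarith)
      (Filter.Eventually.of_forall fun x => sq_nonneg _) ?_
    exact ContinuousOn.intervalIntegrable (by rw [uIcc_of_le hpi.le]; exact hcont.pow 2)
  rw [hab] at h1
  have h2 : K * w ^ 5 / 30 ≤ w ^ 2 + Q * w ^ 4 / 8 :=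
    h1.trans (mul_le_of_le_one_right (by positivity) hI)
  -- The window is not much shorter than a wavelength `Q^(-1/2)`, so the `w²` term is absorbed; `30
  -- (64 + 1/8) ≤ 1950`.
  have h3 : w ^ 2 ≤ 64 * Q * w ^ 4 := by nlinarith [pow_pos hw 2]
  have h4 : K * w * w ^ 4 ≤ 1950 * Q * w ^ 4 := by
    have : 0 ≤ Q * w ^ 4 := by positivity
    linarith
  exact le_of_mul_le_mul_right h4 (by positivity)

/-- The WKB energy bound for the potential `q = Q - μ cot²`. -/
theorem wkb_energy_ge_spherical {b : ℝ} (hμ : 0 ≤ μ) (hc : 0 < c) (hcb : c ≤ b) (hb : b ≤ π / 2)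
    (hpos : 0 < sphericalPotential Q μ c)
    (hu : ∀ x ∈ Ioo 0 π, HasDerivAt u (v x) x)
    (hv : ∀ x ∈ Ioo 0 π, HasDerivAt v (-sphericalPotential Q μ x * u x) x)
    (hM : ∀ x ∈ Ioo 0 π, u x ^ 2 ≤ M) (huc : u c ^ 2 = M) (hvc : v c = 0) :
    √(sphericalPotential Q μ c) * M ≤
      (v b ^ 2 + sphericalPotential Q μ b * u b ^ 2) / √(sphericalPotential Q μ b) +
      μ * ((cos b / sin b) * (1 + (cos b / sin b) ^ 2)) / √(sphericalPotential Q μ b) ^ 3 *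
        (u b * v b) := by
  have hpi := pi_pos
  have hsub : ∀ x ∈ Icc c b, x ∈ Ioo 0 π := fun x hx =>
    ⟨hc.trans_le hx.1, by linarith [hx.2]⟩
  set q := sphericalPotential Q μ with hq
  let t : ℝ → ℝ := fun x => cos x / sin x
  let r : ℝ → ℝ := fun x => √(q x)
  have hqpos : ∀ x ∈ Icc c b, 0 < q x := fun x hx =>
    hpos.trans_le (sphericalPotential_mono hμ hc hx.1 (hx.2.trans hb))
  have hrpos : ∀ x ∈ Icc c b, 0 < r x := fun x hx => sqrt_pos.2 (hqpos x hx)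
  have hrq : ∀ x ∈ Icc c b, q x = r x ^ 2 := fun x hx => (sq_sqrt (hqpos x hx).le).symm
  have htnn : ∀ x ∈ Icc c b, 0 ≤ t x := fun x hx =>
    cos_div_sin_nonneg (hsub x hx).1.le (hx.2.trans hb)
  have hs : ∀ x ∈ Icc c b, sin x ≠ 0 := fun x hx =>
    (sin_pos_of_pos_of_lt_pi (hsub x hx).1 (hsub x hx).2).ne'
  have ht : ∀ x ∈ Icc c b, HasDerivAt t (-(1 + t x ^ 2)) x := fun x hx =>
    hasDerivAt_cos_div_sin (hs x hx)
  have hqd : ∀ x ∈ Icc c b, HasDerivAt q (2 * μ * (t x * (1 + t x ^ 2))) x := fun x hx =>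
    hasDerivAt_sphericalPotential Q μ (hs x hx)
  have hr : ∀ x ∈ Icc c b, HasDerivAt r (μ * (t x * (1 + t x ^ 2)) / r x) x := fun x hx => by
    refine HasDerivAt.congr_deriv ((hqd x hx).sqrt (hqpos x hx).ne') ?_
    simp only [r]; field_simp
  -- Here `h = q^(-1/2)`. By `t' = -(1 + t²)` and `r' = μ t (1 + t²)/r`, its derivatives are, up to
  -- sign, polynomials in `t` and `μ` with nonnegative coefficients over odd powers of `r`, so their
  -- signs can be read off.
  let h : ℝ → ℝ := fun x => (r x)⁻¹
  let h1 : ℝ → ℝ := fun x => -(μ * (t x + t x ^ 3) / r x ^ 3)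
  let h2 : ℝ → ℝ := fun x => μ * (1 + 4 * t x ^ 2 + 3 * t x ^ 4) / r x ^ 3 +
    3 * μ ^ 2 * (t x ^ 2 + 2 * t x ^ 4 + t x ^ 6) / r x ^ 5
  let h3 : ℝ → ℝ := fun x => -((1 + t x ^ 2) * (μ * (8 * t x + 12 * t x ^ 3) / r x ^ 3 +
    3 * μ ^ 2 * (t x * (1 + 4 * t x ^ 2 + 3 * t x ^ 4)) / r x ^ 5 +
    3 * μ ^ 2 * (2 * t x + 8 * t x ^ 3 + 6 * t x ^ 5) / r x ^ 5 +
    15 * μ ^ 3 * (t x * (t x ^ 2 + 2 * t x ^ 4 + t x ^ 6)) / r x ^ 7))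
  have key := wkb_energy_ge (u := u) (v := v) (q := q) (h := h) (h1 := h1) (h2 := h2) (h3 := h3)
    (M := M) hcb
    (fun x hx => hu x (hsub x hx)) (fun x hx => hv x (hsub x hx)) hqd ?_ ?_ ?_ ?_ ?_ ?_
    (fun x hx => hM x (hsub x hx)) huc hvc
  · have hb0 : r b ≠ 0 := (hrpos b ⟨hcb, le_rfl⟩).ne'
    have hc0 : r c ≠ 0 := (hrpos c ⟨le_rfl, hcb⟩).ne'
    have e1 : h c * q c * M = r c * M := by
      rw [hrq c ⟨le_rfl, hcb⟩]; simp only [h]; field_simp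
    rw [e1] at key
    refine key.trans (le_of_eq ?_)
    simp only [h, h1, t, r, q]; ring
  · intro x hx
    refine HasDerivAt.congr_deriv ((hr x hx).inv (hrpos x hx).ne') ?_
    have := (hrpos x hx).ne'
    simp only [h1]; field_simp
  · intro x hx
    have := (hrpos x hx).ne'
    refine HasDerivAt.congr_deriv (((((ht x hx).add ((ht x hx).pow 3)).const_mul μ).div
      ((hr x hx).pow 3) (pow_ne_zero 3 this)).neg) ?_
    simp [h2]; field_simp; ring
  · intro x hx
    have := (hrpos x hx).ne'
    refine HasDerivAt.congr_deriv ((((((((ht x hx).pow 2).const_mul 4).const_add 1).add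
      (((ht x hx).pow 4).const_mul 3)).const_mul μ).div
      ((hr x hx).pow 3) (pow_ne_zero 3 this)).add
      ((((((ht x hx).pow 2).add (((ht x hx).pow 4).const_mul 2)).add ((ht x hx).pow 6)).const_mul
        (3 * μ ^ 2)).div ((hr x hx).pow 5) (pow_ne_zero 5 this))) ?_
    simp [h3]; field_simp; ring
  · intro x hx
    have := (hrpos x hx).ne'
    rw [hrq x hx]; simp only [h, h1]; field_simp; ring
  · intro x hx
    have := hrpos x hx
    have := htnn x hx
    exact neg_nonpos.2 (by positivity)
  · have := hrpos b ⟨hcb, le_rfl⟩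
    have := htnn b ⟨hcb, le_rfl⟩
    simp only [h2]; positivity

/-- Converts the WKB energy into the plain one, with `R = √Q`. By `2 R U V ≤ V² + R² U²`, the main
term and the cross term are each at most `2/R` times the plain energy. -/
theorem energy_ge_of_wkb {r R q k U V B : ℝ} (hR : 0 < R) (hr : 0 < r) (hRr : R ≤ 2 * r)
    (hq : q ≤ R ^ 2) (hk0 : 0 ≤ k) (hk : k ≤ 4)
    (hB : B ≤ (V ^ 2 + q * U ^ 2) / r + k * (U * V)) :
    R * B / 4 ≤ V ^ 2 + R ^ 2 * U ^ 2 := by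
  set E := V ^ 2 + R ^ 2 * U ^ 2 with hE
  have hE0 : 0 ≤ E := by positivity
  have h1 : (V ^ 2 + q * U ^ 2) / r ≤ 2 * E / R := by
    rw [div_le_div_iff₀ hr hR]
    have : V ^ 2 + q * U ^ 2 ≤ E := by rw [hE]; gcongr
    calc _ ≤ E * R := by gcongr
      _ ≤ E * (2 * r) := by gcongr
      _ = _ := by ring
  have h2 : k * (U * V) ≤ 2 * E / R := by
    have h3 : U * V ≤ E / (2 * R) := by
      rw [le_div_iff₀ (by positivity), hE]
      nlinarith [sq_nonneg (V - R * U)]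
    calc _ ≤ k * (E / (2 * R)) := by gcongr
      _ ≤ 4 * (E / (2 * R)) := by gcongr
      _ = _ := by ring
  have h4 : B ≤ 4 * E / R := by
    have : 4 * E / R = 2 * E / R + 2 * E / R := by ring
    linarith
  rw [le_div_iff₀ hR] at h4
  linarith

-- The oscillatory regime. The WKB energy is at least `√q(c) M ≥ √L M`; comparing it with unit mass
-- on a window at the equator gives `√L M ≲ L`.
set_option maxHeartbeats 800000 in
theorem max_sq_le_of_potential_ge {μ : ℝ} (hμ : 0 ≤ μ) (hL : 1 / 2 ≤ L)
    (hc : c ∈ Ioc 0 (π / 2))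
    (hq0 : L ≤ sphericalPotential (L ^ 2 - μ) μ c)
    (hcont : ContinuousOn u (Icc 0 π))
    (hu : ∀ x ∈ Ioo 0 π, HasDerivAt u (v x) x)
    (hv : ∀ x ∈ Ioo 0 π, HasDerivAt v (-sphericalPotential (L ^ 2 - μ) μ x * u x) x)
    (hM : ∀ x ∈ Ioo 0 π, u x ^ 2 ≤ M) (huc : u c ^ 2 = M) (hvc : v c = 0)
    (hint : ∫ x in (0 : ℝ)..π, u x ^ 2 ≤ 1) :
    M ≤ 62400 * √L := by
  have hpi := pi_gt_three
  have hM0 : 0 ≤ M := huc ▸ sq_nonneg _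
  have hLpos : 0 < L := by linarith
  set Q := L ^ 2 - μ with hQdef
  set q := sphericalPotential Q μ with hq
  have hqQ : ∀ x, q x ≤ Q := fun x => sphericalPotential_le hμ
  have hLQ : L ≤ Q := hq0.trans (hqQ c)
  have hQpos : 0 < Q := hLpos.trans_le hLQ
  set R := √Q with hR
  have hRpos : 0 < R := sqrt_pos.2 hQpos
  have hRQ : R ^ 2 = Q := sq_sqrt hQpos.le
  have hRL : R ≤ L := abs_le_of_sq_le_sq' (by rw [hRQ]; linarith) hLpos.le |>.2
  -- The length is chosen so that `μ cot² ≤ L² (4w)² = Q/4` within `2w` of `π/2`; moreover `Q w² ≥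
  -- 1/64`, because `Q ≥ L`.
  set w := R / (8 * L) with hw
  have hwpos : 0 < w := by positivity
  have hwL : 8 * L * w = R := by rw [hw]; field_simp
  have hw8 : w ≤ 1 / 8 := by rw [hw, div_le_iff₀ (by positivity)]; linarith
  have hQw : 1 ≤ 64 * (Q * w ^ 2) := by
    have h1 : 64 * (Q * w ^ 2) * L ^ 2 = Q ^ 2 := by
      have h2 : 64 * L ^ 2 * w ^ 2 = Q := by rw [← hRQ, ← hwL]; ring
      linear_combination Q * h2
    have h2 : 1 * L ^ 2 ≤ 64 * (Q * w ^ 2) * L ^ 2 := by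
      rw [h1, one_mul]; gcongr
    exact le_of_mul_le_mul_right h2 (by positivity)
  have hμL : μ ≤ L ^ 2 := by linarith
  have hrootL : 0 < √L := sqrt_pos.2 hLpos
  have hrootsq : √L * √L = L := mul_self_sqrt hLpos.le
  have hqlow : ∀ x, π / 2 - 2 * w ≤ x → x ≤ π / 2 → 3 / 4 * Q ≤ q x := by
    intro x hx1 hx2
    have h1 := cos_div_sin_le (by linarith) hx1 hx2
    have h0 := cos_div_sin_nonneg (by linarith) hx2
    have h2 : μ * (cos x / sin x) ^ 2 ≤ L ^ 2 * (2 * (2 * w)) ^ 2 := by gcongr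
    have h3 : L ^ 2 * (2 * (2 * w)) ^ 2 = Q / 4 := by rw [← hRQ, ← hwL]; ring
    have h4 : q x = Q - μ * (cos x / sin x) ^ 2 := rfl
    linarith
  by_cases hcw : c ≤ π / 2 - w
  · have hK : ∀ x ∈ Icc (π / 2 - w) (π / 2), R * √L * M / 4 ≤ v x ^ 2 + Q * u x ^ 2 := by
      intro x hx
      have key := wkb_energy_ge_spherical hμ hc.1 (hcw.trans hx.1) hx.2 (hLpos.trans_le hq0)
        hu hv hM huc hvc
      rw [← hq] at key
      have hqx := hqlow x (by linarith [hx.1]) hx.2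
      have hqxpos : 0 < q x := by linarith
      set r := √(q x) with hr
      have hrpos : 0 < r := sqrt_pos.2 hqxpos
      have hrq : r ^ 2 = q x := sq_sqrt hqxpos.le
      have hrR : R ≤ 2 * r := by
        refine abs_le_of_sq_le_sq' ?_ (by positivity) |>.2
        rw [mul_pow, hrq, hRQ]; linarith
      have ht := cos_div_sin_le (by linarith) hx.1 hx.2
      have ht0 := cos_div_sin_nonneg (by linarith [hx.1]) hx.2
      set t := cos x / sin x with htdef
      -- Besides `μ ≤ L²` and `t ≤ 2w`, this needs `L ≤ Q`, which absorbs `L R` into `R³`.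
      have hcoef : μ * (t * (1 + t ^ 2)) / r ^ 3 ≤ 4 := by
        have h1 : μ * (t * (1 + t ^ 2)) ≤ L ^ 2 * (2 * w * 2) := by
          have : 1 + t ^ 2 ≤ 2 := by nlinarith
          gcongr
        have h2 : L ^ 2 * (2 * w * 2) = L * R / 2 := by rw [← hwL]; ring
        have h3 : L * R ≤ R ^ 3 := by
          have : R ^ 3 = Q * R := by rw [← hRQ]; ring
          rw [this]; gcongr
        have h4 : R ^ 3 ≤ 8 * r ^ 3 := by
          calc R ^ 3 ≤ (2 * r) ^ 3 := by gcongr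
            _ = _ := by ring
        rw [div_le_iff₀ (by positivity)]
        linarith
      have hcoef0 : 0 ≤ μ * (t * (1 + t ^ 2)) / r ^ 3 := by positivity
      have h3 : √L * M ≤ √(q c) * M := by gcongr
      have := energy_ge_of_wkb hRpos hrpos hrR (hRQ ▸ hqQ x) hcoef0 hcoef (h3.trans key)
      rw [hRQ] at this
      linarith
    have h := energy_bound_window hμ hwpos hQw (by linarith) le_rfl (by ring) hu hv hcont hint hK
    have h1 : R * √L * M / 4 * w * (8 * L) ≤ 1950 * Q * (8 * L) := by gcongr
    have h2 : R * √L * M / 4 * w * (8 * L) = Q * (√L * M / 4) := by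
      rw [← hRQ]; linear_combination (R * √L * M / 4) * hwL
    have h3 : Q * (√L * M / 4) ≤ Q * (1950 * (8 * L)) := by linarith
    have h4 : √L * M / 4 ≤ 1950 * (8 * L) := le_of_mul_le_mul_left h3 hQpos
    have h5 : √L * M ≤ √L * (62400 * √L) := by nlinarith
    exact le_of_mul_le_mul_left h5 hrootL
  · push Not at hcw
    -- With `c` within `w` of `π/2`, the window is moved one step to the left, so that it precedes
    -- `c`. Sonin's function decreases there and equals `M` at `c`.
    have hK : ∀ x ∈ Icc (π / 2 - 2 * w) (π / 2 - w), 3 / 4 * Q * M ≤ v x ^ 2 + Q * u x ^ 2 := by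
      intro x hx
      have hsub : ∀ y ∈ Icc x c, y ∈ Ioo 0 π := fun y hy =>
        ⟨by linarith [hx.1, hy.1], by linarith [hy.2, hc.2]⟩
      have hql : ∀ y ∈ Icc x c, 3 / 4 * Q ≤ q y := fun y hy =>
        hqlow y (by linarith [hx.1, hy.1]) (hy.2.trans hc.2)
      have key := sonin_le_of_deriv_nonneg (u := u) (v := v) (q := q) (a := x) (b := c)
        (by linarith [hx.2]) (fun y hy => hu y (hsub y hy)) (fun y hy => hv y (hsub y hy))
        (fun y hy => hasDerivAt_sphericalPotential Q μ
          (sin_pos_of_pos_of_lt_pi (hsub y hy).1 (hsub y hy).2).ne')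
        (fun y hy => by linarith [hql y hy]) (fun y hy => by
          have := cos_div_sin_nonneg (hsub y hy).1.le (hy.2.trans hc.2)
          positivity)
      rw [huc, hvc] at key
      have hqx := hql x ⟨le_rfl, by linarith [hx.2]⟩
      have hqxpos : 0 < q x := by linarith
      have h1 : q x * M ≤ q x * (u x ^ 2 + v x ^ 2 / q x) := by
        gcongr; simpa using key
      have h2 : q x * (u x ^ 2 + v x ^ 2 / q x) = q x * u x ^ 2 + v x ^ 2 := by field_simp
      have h3 : q x * u x ^ 2 ≤ Q * u x ^ 2 := by gcongr; exact hqQ x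
      have h4 : 3 / 4 * Q * M ≤ q x * M := by gcongr
      linarith
    have h := energy_bound_window hμ hwpos hQw (by linarith) (by linarith) (by ring) hu hv
      hcont hint hK
    have h1 : 3 / 4 * M * w ≤ 1950 := by
      have : Q * (3 / 4 * M * w) ≤ Q * 1950 := by linarith
      exact le_of_mul_le_mul_left this hQpos
    have hRL2 : √L ≤ R := sqrt_le_sqrt hLQ
    have h2 : 3 / 4 * M * R ≤ 15600 * L := by rw [← hwL]; nlinarith
    have h3 : 3 / 4 * M * √L ≤ 15600 * L := le_trans (by gcongr) h2
    have h5 : √L * M ≤ √L * (62400 * √L) := by nlinarith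
    exact le_of_mul_le_mul_left h5 hrootL

/-- The threshold `q(c) = L` balances the two regimes: the left-hand bound is of order `√A` with `A
= L`, and the WKB bound of order `L/√q(c)`. -/
theorem max_sq_le_of_nonneg {μ : ℝ} (hμ : 0 ≤ μ) (hL : 1 / 2 ≤ L)
    (hc : c ∈ Ioc 0 (π / 2)) (hcont : ContinuousOn u (Icc 0 π)) (hu0 : u 0 = 0)
    (hu : ∀ x ∈ Ioo 0 π, HasDerivAt u (v x) x)
    (hv : ∀ x ∈ Ioo 0 π, HasDerivAt v (-sphericalPotential (L ^ 2 - μ) μ x * u x) x)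
    (hM : ∀ x ∈ Ioo 0 π, u x ^ 2 ≤ M) (huc : u c ^ 2 = M) (hvc : v c = 0)
    (hint : ∫ x in (0 : ℝ)..π, u x ^ 2 ≤ 1) :
    M ≤ 62400 * √L := by
  have hpi := pi_pos
  rcases le_total L (sphericalPotential (L ^ 2 - μ) μ c) with h | h
  · exact max_sq_le_of_potential_ge hμ hL hc h hcont hu hv hM huc hvc hint
  · have hsub : ∀ x ∈ Ioc 0 c, x ∈ Ioo 0 π := fun x hx => ⟨hx.1, by linarith [hx.2, hc.2]⟩
    have := max_sq_le_sqrt (A := L) hc.1 (by linarith)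
      (hcont.mono (Icc_subset_Icc le_rfl (by linarith [hc.2]))) hu0
      (fun x hx => hu x (hsub x hx)) (fun x hx => hv x (hsub x hx))
      (fun x hx => (sphericalPotential_mono hμ hx.1 hx.2 hc.2).trans h)
      (fun x hx => hM x (hsub x hx)) huc hvc ?_
    · linarith [sqrt_nonneg L]
    · refine le_trans ?_ hint
      refine intervalIntegral.integral_mono_interval le_rfl hc.1.le (by linarith [hc.2])
        (Filter.Eventually.of_forall fun x => sq_nonneg _) ?_
      exact ContinuousOn.intervalIntegrable (by rw [uIcc_of_le hpi.le]; exact hcont.pow 2)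

/-- The Legendre case, where the potential decreases on `(0, π/2]`. -/
theorem max_sq_le_of_eq_neg_quarter (hL : 1 / 2 ≤ L)
    (hc : c ∈ Ioc 0 (π / 2)) (hcont : ContinuousOn u (Icc 0 π))
    (hu : ∀ x ∈ Ioo 0 π, HasDerivAt u (v x) x)
    (hv : ∀ x ∈ Ioo 0 π,
      HasDerivAt v (-sphericalPotential (L ^ 2 + 1 / 4) (-1 / 4) x * u x) x)
    (huc : u c ^ 2 = M) (hvc : v c = 0)
    (hint : ∫ x in (0 : ℝ)..π, u x ^ 2 ≤ 1) :
    M ≤ 62400 * √L := by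
  have hpi := pi_gt_three
  have hM0 : 0 ≤ M := huc ▸ sq_nonneg _
  set Q := L ^ 2 + 1 / 4 with hQ
  have hQ1 : 1 / 2 ≤ Q := by nlinarith
  set q := sphericalPotential Q (-1 / 4) with hq
  have hqv : ∀ x, q x = Q + (cos x / sin x) ^ 2 / 4 := fun x => by
    simp only [hq, sphericalPotential]; ring
  have hqpos : ∀ x, 0 < q x := fun x => by rw [hqv]; positivity
  have hqd : ∀ x ∈ Ioo 0 π, HasDerivAt q
      (2 * (-1 / 4) * ((cos x / sin x) * (1 + (cos x / sin x) ^ 2))) x := fun x hx =>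
    hasDerivAt_sphericalPotential _ _ (sin_pos_of_pos_of_lt_pi hx.1 hx.2).ne'
  have hqn : ∀ x, 0 < x → x ≤ π / 2 →
      2 * (-1 / 4) * ((cos x / sin x) * (1 + (cos x / sin x) ^ 2)) ≤ 0 := fun x h0 h1 => by
    have := cos_div_sin_nonneg h0.le h1
    exact mul_nonpos_of_nonpos_of_nonneg (by norm_num) (by positivity)
  have hqe : q (π / 2) = Q := by rw [hqv]; simp
  -- Sonin's function increases from `c` to `π/2`. From `π/2` back to the left the energy `u'² + q
  -- u²` increases, which yields `hK`.
  have h1 : M ≤ u (π / 2) ^ 2 + v (π / 2) ^ 2 / Q := by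
    have hsub : ∀ y ∈ Icc c (π / 2), y ∈ Ioo 0 π := fun y hy =>
      ⟨hc.1.trans_le hy.1, by linarith [hy.2]⟩
    have key := sonin_le_of_deriv_nonpos (u := u) (v := v) (q := q) hc.2
      (fun y hy => hu y (hsub y hy)) (fun y hy => hv y (hsub y hy))
      (fun y hy => hqd y (hsub y hy)) (fun y _ => hqpos y)
      (fun y hy => hqn y (hsub y hy).1 hy.2)
    rw [huc, hvc, hqe] at key
    simpa using key
  have h2 : Q * M ≤ v (π / 2) ^ 2 + Q * u (π / 2) ^ 2 := by
    have h3 : Q * M ≤ Q * (u (π / 2) ^ 2 + v (π / 2) ^ 2 / Q) := by gcongr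
    have h4 : Q * (u (π / 2) ^ 2 + v (π / 2) ^ 2 / Q) = Q * u (π / 2) ^ 2 + v (π / 2) ^ 2 := by
      field_simp
    linarith
  have hsub : ∀ y ∈ Icc (π / 2 - 1) (π / 2), y ∈ Ioo 0 π := fun y hy =>
    ⟨by linarith [hy.1], by linarith [hy.2]⟩
  -- On this unit window `cot ≤ 2`, hence `q ≤ Q + 1 ≤ 3Q` as `Q ≥ 1/2`.
  have hqle : ∀ y ∈ Icc (π / 2 - 1) (π / 2), q y ≤ 3 * Q := fun y hy => by
    have h3 := cos_div_sin_le le_rfl hy.1 hy.2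
    have h4 := cos_div_sin_nonneg (hsub y hy).1.le hy.2
    rw [hqv]; nlinarith
  have hK : ∀ x ∈ Icc (π / 2 - 1) (π / 2), Q * M ≤ v x ^ 2 + 3 * Q * u x ^ 2 := fun x hx => by
    have hsub' : ∀ y ∈ Icc x (π / 2), y ∈ Icc (π / 2 - 1) (π / 2) := fun y hy =>
      ⟨hx.1.trans hy.1, hy.2⟩
    have key := energy_le_of_deriv_nonpos (u := u) (v := v) (q := q) hx.2
      (fun y hy => hu y (hsub y (hsub' y hy))) (fun y hy => hv y (hsub y (hsub' y hy)))
      (fun y hy => hqd y (hsub y (hsub' y hy)))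
      (fun y hy => hqn y (hsub y (hsub' y hy)).1 hy.2)
    rw [hqe] at key
    have : q x * u x ^ 2 ≤ 3 * Q * u x ^ 2 := by gcongr; exact hqle x hx
    linarith
  have h := energy_le_integral_sq (u := u) (v := v) (q := q) (by linarith) (by positivity)
    (fun x hx => hu x (hsub x hx)) (fun x hx => hv x (hsub x hx))
    (sphericalPotential_continuousOn _ _ (by linarith) (by linarith)) hqle hK
  have hI : (∫ x in (π / 2 - 1)..(π / 2), u x ^ 2) ≤ 1 := by
    refine le_trans ?_ hint
    refine intervalIntegral.integral_mono_interval (by linarith) (by linarith) (by linarith)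
      (Filter.Eventually.of_forall fun x => sq_nonneg _) ?_
    exact ContinuousOn.intervalIntegrable (by rw [uIcc_of_le (by linarith)]; exact hcont.pow 2)
  rw [sub_sub_cancel] at h
  have h5 : Q * M / 30 ≤ 1 + 3 * Q / 8 := by
    have : (1 + 3 * Q / 8) * (∫ x in (π / 2 - 1)..(π / 2), u x ^ 2) ≤ 1 + 3 * Q / 8 :=
      mul_le_of_le_one_right (by positivity) hI
    norm_num at h; linarith
  have h6 : M ≤ 100 := by
    have : Q * M ≤ Q * 100 := by linarith
    exact le_of_mul_le_mul_left this (by linarith)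
  have h7 : 1 / 2 ≤ √L := le_sqrt_of_sq_le (by linarith)
  linarith

end SphericalPotential

/-! ### Jacobi's differential equation -/

section Jacobi

theorem jacobiInner_add_left (α : ℕ) (p q r : ℝ[X]) :
    jacobiInner α (p + q) r = jacobiInner α p r + jacobiInner α q r := by
  unfold jacobiInner
  rw [← intervalIntegral.integral_add]
  · simp [add_mul]
  all_goals exact Continuous.intervalIntegrable (by fun_prop) _ _

theorem jacobiInner_monicJacobi_eq_zero (α n : ℕ) {p : ℝ[X]} (hp : p.degree < n) :
    jacobiInner α p (monicJacobi α n) = 0 := by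
  have key : ∀ k ≤ n, ∀ p : ℝ[X], p.degree < k → jacobiInner α p (monicJacobi α n) = 0 := by
    intro k
    induction k with
    | zero =>
      intro _ p hp
      have : p = 0 := by simpa [Nat.WithBot.lt_zero_iff] using hp
      simp [this, jacobiInner]
    | succ k ih =>
      intro hk p hp
      obtain ⟨hdeg, hmonic⟩ := monicJacobi_natDegree_monic α k
      set r := p - C (p.coeff k) * monicJacobi α k with hr
      have hrdeg : r.degree < k := by
        rw [degree_lt_iff_coeff_zero]
        intro j hj
        rcases hj.eq_or_lt with rfl | hlt
        · have : (monicJacobi α k).coeff k = 1 := by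
            simpa [Monic, leadingCoeff, hdeg] using hmonic
          simp [hr, this]
        · have h1 : p.coeff j = 0 := (degree_lt_iff_coeff_zero p (k + 1)).1 hp j hlt
          have h2 : (monicJacobi α k).coeff j = 0 := coeff_eq_zero_of_natDegree_lt (by rwa [hdeg])
          simp [hr, h1, h2]
      have hsum : p = r + C (p.coeff k) * monicJacobi α k := by rw [hr]; ring
      rw [hsum, jacobiInner_add_left, jacobiInner_C_mul_left, ih (by omega) r hrdeg,
        jacobiInner_comm, monicJacobi_orthogonal α (by omega)]
      simp
  exact key n le_rfl p hp

/-- The Jacobi operator `(1 - x²) p'' - 2 (α + 1) x p'`. -/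
noncomputable def jacobiOp (α : ℕ) (p : ℝ[X]) : ℝ[X] :=
  (1 - X ^ 2) * derivative (derivative p) - C (2 * ((α : ℝ) + 1)) * X * derivative p

/-- Integration by parts: `(1 - x²)^α` times the operator is `((1 - x²)^(α+1) p')'`, and the
boundary terms vanish. The right-hand side is symmetric in `p` and `q`. -/
theorem jacobiInner_jacobiOp (α : ℕ) (p q : ℝ[X]) :
    jacobiInner α (jacobiOp α p) q =
      -∫ x in (-1 : ℝ)..1, (derivative p).eval x * (derivative q).eval x * (1 - x ^ 2) ^ (α + 1) := by
  have hd : ∀ x ∈ Set.uIcc (-1 : ℝ) 1, HasDerivAt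
      (fun x => (1 - x ^ 2) ^ (α + 1) * ((derivative p).eval x * q.eval x))
      ((jacobiOp α p).eval x * q.eval x * (1 - x ^ 2) ^ α +
        (derivative p).eval x * (derivative q).eval x * (1 - x ^ 2) ^ (α + 1)) x := by
    intro x _
    refine HasDerivAt.congr_deriv (((((hasDerivAt_id x).pow 2).const_sub 1).pow (α + 1)).mul
      (((derivative p).hasDerivAt x).mul (q.hasDerivAt x))) ?_
    simp [jacobiOp]; ring
  have hI := intervalIntegral.integral_eq_sub_of_hasDerivAt hd
    (Continuous.intervalIntegrable (by fun_prop) _ _)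
  rw [intervalIntegral.integral_add (Continuous.intervalIntegrable (by fun_prop) _ _)
    (Continuous.intervalIntegrable (by fun_prop) _ _)] at hI
  norm_num at hI
  unfold jacobiInner
  linarith

theorem jacobiInner_jacobiOp_comm (α : ℕ) (p q : ℝ[X]) :
    jacobiInner α (jacobiOp α p) q = jacobiInner α p (jacobiOp α q) := by
  rw [jacobiInner_comm α p, jacobiInner_jacobiOp, jacobiInner_jacobiOp]
  simp only [mul_comm (eval _ (derivative p))]

/-- The operator is triangular in the monomial basis: it does not raise the degree, and its diagonal
entries are the eigenvalues. -/
theorem jacobiOp_coeff (α : ℕ) (p : ℝ[X]) (j : ℕ) :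
    (jacobiOp α p).coeff j =
      ((j : ℝ) + 1) * (j + 2) * p.coeff (j + 2) - (j : ℝ) * (j + 2 * α + 1) * p.coeff j := by
  have h : jacobiOp α p = derivative (derivative p) - derivative (derivative p) * X ^ 2
      - C (2 * ((α : ℝ) + 1)) * (derivative p * X) := by rw [jacobiOp]; ring
  rw [h, coeff_sub, coeff_sub, coeff_C_mul]
  rcases j with _ | _ | j
  · simp [coeff_derivative]; ring
  · simp [coeff_derivative, coeff_mul_X_pow']; ring
  · simp [coeff_derivative, coeff_mul_X_pow']; ring

/-- The Jacobi differential equation. -/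
theorem jacobiOp_monicJacobi (α n : ℕ) :
    jacobiOp α (monicJacobi α n) = -(C ((n : ℝ) * (n + 2 * α + 1)) * monicJacobi α n) := by
  set p := monicJacobi α n with hp
  obtain ⟨hdeg, hmonic⟩ := monicJacobi_natDegree_monic α n
  rw [← hp] at hdeg hmonic
  set r := jacobiOp α p + C ((n : ℝ) * (n + 2 * α + 1)) * p with hr
  have hlow : ∀ s : ℝ[X], s.degree < n → (jacobiOp α s).degree < n := by
    intro s hs
    rw [degree_lt_iff_coeff_zero] at hs ⊢
    intro j hj
    rw [jacobiOp_coeff, hs j hj, hs (j + 2) (by omega)]; simp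
  have hrdeg : r.degree < n := by
    rw [degree_lt_iff_coeff_zero]
    intro j hj
    have h2 : p.coeff (j + 2) = 0 := coeff_eq_zero_of_natDegree_lt (by omega)
    rw [hr, coeff_add, coeff_C_mul, jacobiOp_coeff, h2]
    rcases hj.eq_or_lt with rfl | hlt
    · ring
    · rw [coeff_eq_zero_of_natDegree_lt (by omega : p.natDegree < j)]; ring
  -- The leading terms cancel in `r`. Symmetry moves the operator onto `r`, so `⟨r, r⟩` pairs `p`
  -- only with polynomials of degree below `n`.
  have hrr : jacobiInner α r r = 0 := by
    conv_lhs => rw [hr]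
    rw [jacobiInner_add_left, jacobiInner_C_mul_left, jacobiInner_jacobiOp_comm,
      jacobiInner_comm α p, jacobiInner_comm α p,
      jacobiInner_monicJacobi_eq_zero α n (hlow r hrdeg),
      jacobiInner_monicJacobi_eq_zero α n hrdeg]
    simp
  have hr0 : r = 0 := by
    by_contra h
    exact (jacobiInner_self_pos α h).ne' hrr
  exact eq_neg_of_add_eq_zero_left hr0

theorem jacobiPoly_ode (α n : ℕ) (x : ℝ) :
    (1 - x ^ 2) * (derivative (derivative (jacobiPoly α n))).eval x
      - 2 * ((α : ℝ) + 1) * x * (derivative (jacobiPoly α n)).eval x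
      + (n : ℝ) * (n + 2 * α + 1) * (jacobiPoly α n).eval x = 0 := by
  have h := congrArg (eval x) (jacobiOp_monicJacobi α n)
  simp only [jacobiOp, eval_sub, eval_mul, eval_one, eval_pow, eval_X, eval_C, eval_neg] at h
  simp only [jacobiPoly, derivative_C_mul, eval_mul, eval_C]
  linear_combination (√(jacobiInner α (monicJacobi α n) (monicJacobi α n)))⁻¹ * h

/-! ### Passage to the angular variable -/

open Real Set

theorem hasDerivAt_sin_rpow (s : ℝ) {φ : ℝ} (h : 0 < sin φ) :
    HasDerivAt (fun φ => sin φ ^ s) (s * sin φ ^ s * (cos φ / sin φ)) φ := by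
  refine HasDerivAt.congr_deriv ((hasDerivAt_sin φ).rpow_const (p := s) (Or.inl h.ne')) ?_
  rw [rpow_sub_one h.ne']
  ring

theorem hasDerivAt_eval_cos (p : ℝ[X]) (φ : ℝ) :
    HasDerivAt (fun φ => p.eval (cos φ)) (-(sin φ * (derivative p).eval (cos φ))) φ := by
  refine HasDerivAt.congr_deriv ((p.hasDerivAt (cos φ)).comp φ (hasDerivAt_cos φ)) ?_
  ring

/-- The function `(sin φ)^(α+1/2) p_n^α(cos φ)`. -/
noncomputable def weightedJacobi (α n : ℕ) (φ : ℝ) : ℝ :=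
  sin φ ^ ((α : ℝ) + 1 / 2) * (jacobiPoly α n).eval (cos φ)

/-- The derivative of `weightedJacobi`. -/
noncomputable def weightedJacobiDeriv (α n : ℕ) (φ : ℝ) : ℝ :=
  sin φ ^ ((α : ℝ) + 1 / 2) * (((α : ℝ) + 1 / 2) * (cos φ / sin φ) *
    (jacobiPoly α n).eval (cos φ) - sin φ * (derivative (jacobiPoly α n)).eval (cos φ))

theorem hasDerivAt_weightedJacobi (α n : ℕ) {φ : ℝ} (h : 0 < sin φ) :
    HasDerivAt (weightedJacobi α n) (weightedJacobiDeriv α n φ) φ := by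
  refine HasDerivAt.congr_deriv ((hasDerivAt_sin_rpow _ h).mul (hasDerivAt_eval_cos _ φ)) ?_
  simp only [weightedJacobiDeriv]; ring

/-- Liouville normal form: the exponent `α + 1/2` removes the first-order term, and `n (n + 2α + 1)
+ (α + 1/2)² = (n + α + 1/2)²`. -/
theorem hasDerivAt_weightedJacobiDeriv (α n : ℕ) {φ : ℝ} (h : 0 < sin φ) :
    HasDerivAt (weightedJacobiDeriv α n)
      (-sphericalPotential (((n : ℝ) + α + 1 / 2) ^ 2 - ((α : ℝ) ^ 2 - 1 / 4))
        ((α : ℝ) ^ 2 - 1 / 4) φ * weightedJacobi α n φ) φ := by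
  refine HasDerivAt.congr_deriv ((hasDerivAt_sin_rpow ((α : ℝ) + 1 / 2) h).mul
    ((((hasDerivAt_cos_div_sin h.ne').const_mul ((α : ℝ) + 1 / 2)).mul
      (hasDerivAt_eval_cos (jacobiPoly α n) φ)).sub ((hasDerivAt_sin φ).mul
        (hasDerivAt_eval_cos (derivative (jacobiPoly α n)) φ)))) ?_
  have hode := jacobiPoly_ode α n (cos φ)
  have hs2 : 1 - cos φ ^ 2 = sin φ ^ 2 := by rw [sin_sq]
  rw [hs2] at hode
  simp only [sphericalPotential, weightedJacobi]
  set t := cos φ / sin φ with ht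
  have hct : cos φ = t * sin φ := by rw [ht]; field_simp
  generalize sin φ ^ ((α : ℝ) + 1 / 2) = S
  generalize (jacobiPoly α n).eval (cos φ) = P at *
  generalize (derivative (jacobiPoly α n)).eval (cos φ) = P1 at *
  generalize (derivative (derivative (jacobiPoly α n))).eval (cos φ) = P2 at *
  rw [hct] at hode ⊢
  linear_combination S * hode

/-- Substitution `x = cos φ`: of the power `(sin φ)^(2α+1)`, one factor is the Jacobian and the rest
is the weight. -/
theorem integral_weightedJacobi_sq (α n : ℕ) :
    ∫ φ in (0 : ℝ)..π, weightedJacobi α n φ ^ 2 = 1 := by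
  have h1 : ∫ φ in (0 : ℝ)..π, weightedJacobi α n φ ^ 2 =
      ∫ φ in (0 : ℝ)..π, ((jacobiPoly α n).eval (cos φ) * (jacobiPoly α n).eval (cos φ) *
        (1 - cos φ ^ 2) ^ α) * sin φ := by
    refine intervalIntegral.integral_congr fun φ hφ => ?_
    rw [uIcc_of_le pi_pos.le] at hφ
    have hs := sin_nonneg_of_nonneg_of_le_pi hφ.1 hφ.2
    have hpow : (sin φ ^ ((α : ℝ) + 1 / 2)) ^ 2 = sin φ ^ (2 * α + 1) := by
      rw [← rpow_natCast, ← rpow_mul hs, ← rpow_natCast]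
      congr 1; push_cast; ring
    simp only [weightedJacobi, mul_pow, hpow, ← sin_sq]
    ring
  have h2 := intervalIntegral.integral_comp_mul_deriv (a := 0) (b := π)
    (f := cos) (f' := fun x => -sin x)
    (g := fun x => (jacobiPoly α n).eval x * (jacobiPoly α n).eval x * (1 - x ^ 2) ^ α)
    (fun x _ => hasDerivAt_cos x) (by fun_prop) (by fun_prop)
  simp only [Function.comp_apply, mul_neg, intervalIntegral.integral_neg, cos_zero, cos_pi] at h2
  rw [h1, ← neg_neg (∫ φ in (0 : ℝ)..π, _), h2, intervalIntegral.integral_symm, neg_neg,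
    jacobiPoly_orthonormal, if_pos rfl]

theorem continuous_weightedJacobi (α n : ℕ) : Continuous (weightedJacobi α n) := by
  have : Continuous fun φ => sin φ ^ ((α : ℝ) + 1 / 2) :=
    continuous_sin.rpow_const fun _ => Or.inr (by positivity)
  exact this.mul ((jacobiPoly α n).continuous.comp continuous_cos)

theorem sphericalPotential_pi_sub (Q μ φ : ℝ) :
    sphericalPotential Q μ (π - φ) = sphericalPotential Q μ φ := by
  simp [sphericalPotential, neg_div]

theorem weightedJacobi_sq_le (α n : ℕ) {φ : ℝ} (hφ : φ ∈ Icc 0 π) :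
    weightedJacobi α n φ ^ 2 ≤ 62400 * √((n : ℝ) + α + 1 / 2) := by
  have hpi := pi_pos
  set u := weightedJacobi α n with hu
  set v := weightedJacobiDeriv α n with hv
  set L := (n : ℝ) + α + 1 / 2 with hL
  have hL2 : 1 / 2 ≤ L := by have : (0 : ℝ) ≤ n + α := by positivity
                             linarith
  set μ := (α : ℝ) ^ 2 - 1 / 4 with hμ
  have hcont : Continuous u := continuous_weightedJacobi α n
  have hud : ∀ x ∈ Ioo 0 π, HasDerivAt u (v x) x := fun x hx =>
    hasDerivAt_weightedJacobi α n (sin_pos_of_pos_of_lt_pi hx.1 hx.2)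
  have hvd : ∀ x ∈ Ioo 0 π, HasDerivAt v (-sphericalPotential (L ^ 2 - μ) μ x * u x) x :=
    fun x hx => hasDerivAt_weightedJacobiDeriv α n (sin_pos_of_pos_of_lt_pi hx.1 hx.2)
  have hα : (α : ℝ) + 1 / 2 ≠ 0 := by positivity
  have hu0 : u 0 = 0 := by
    simp only [hu, weightedJacobi, sin_zero, zero_rpow hα, zero_mul]
  have hupi : u π = 0 := by
    simp only [hu, weightedJacobi, sin_pi, zero_rpow hα, zero_mul]
  have hint : ∫ x in (0 : ℝ)..π, u x ^ 2 = 1 := integral_weightedJacobi_sq α n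
  obtain ⟨c, hc, hmax⟩ := isCompact_Icc.exists_isMaxOn (nonempty_Icc.2 hpi.le)
    (hcont.pow 2).continuousOn (s := Icc 0 π)
  have hmax' : ∀ x ∈ Icc 0 π, u x ^ 2 ≤ u c ^ 2 := fun x hx => hmax hx
  refine (hmax' φ hφ).trans ?_
  -- A nonzero value at `c` keeps `c` off the endpoints and allows `u` to be cancelled from `2 u u'
  -- = 0`.
  by_cases huc : u c = 0
  · rw [huc, zero_pow two_ne_zero]; positivity
  have hc0 : 0 < c := hc.1.lt_of_ne fun h => huc (h ▸ hu0)
  have hcpi : c < π := hc.2.lt_of_ne fun h => huc (h ▸ hupi)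
  have hvc : v c = 0 := by
    have hloc : IsLocalMax (fun x => u x ^ 2) c :=
      hmax.isLocalMax (Icc_mem_nhds hc0 hcpi)
    have := hloc.hasDerivAt_eq_zero ((hud c ⟨hc0, hcpi⟩).pow 2)
    simpa [huc] using this
  -- Stated for a general solution so that it also applies to the reflection `φ ↦ π - φ`, which
  -- preserves the potential.
  have main : ∀ (f g : ℝ → ℝ) (d : ℝ), Continuous f → f 0 = 0 → d ∈ Ioc 0 (π / 2) →
      (∀ x ∈ Ioo 0 π, HasDerivAt f (g x) x) →
      (∀ x ∈ Ioo 0 π, HasDerivAt g (-sphericalPotential (L ^ 2 - μ) μ x * f x) x) →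
      (∀ x ∈ Ioo 0 π, f x ^ 2 ≤ f d ^ 2) → g d = 0 → (∫ x in (0 : ℝ)..π, f x ^ 2) = 1 →
      f d ^ 2 ≤ 62400 * √L := by
    intro f g d hf hf0 hd hfd hgd hM hgd0 hfint
    -- As `α` is an integer, `μ` is negative only for `α = 0`.
    rcases Nat.eq_zero_or_pos α with hα0 | hpos
    · have hμ' : μ = -1 / 4 := by rw [hμ, hα0]; norm_num
      have hQ : L ^ 2 - -1 / 4 = L ^ 2 + 1 / 4 := by ring
      simp only [hμ', hQ] at hgd
      exact max_sq_le_of_eq_neg_quarter hL2 hd hf.continuousOn hfd hgd rfl hgd0 hfint.le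
    · have : (1 : ℝ) ≤ α := by exact_mod_cast hpos
      exact max_sq_le_of_nonneg (by rw [hμ]; nlinarith) hL2 hd hf.continuousOn hf0 hfd hgd hM
        rfl hgd0 hfint.le
  rcases le_total c (π / 2) with hle | hle
  · exact main u v c hcont hu0 ⟨hc0, hle⟩ hud hvd
      (fun x hx => hmax' x (Ioo_subset_Icc_self hx)) hvc hint
  · have hrefl : ∀ x ∈ Ioo 0 π, π - x ∈ Ioo 0 π := fun x hx =>
      ⟨by linarith [hx.2], by linarith [hx.1]⟩
    have hsub : ∀ x, HasDerivAt (fun y : ℝ => π - y) (-1) x := fun x =>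
      (hasDerivAt_id x).const_sub π
    have := main (fun x => u (π - x)) (fun x => -v (π - x)) (π - c) (by fun_prop)
      (by simpa using hupi) ⟨by linarith, by linarith⟩
      (fun x hx => ((hud _ (hrefl x hx)).comp x (hsub x)).congr_deriv (by ring))
      (fun x hx => ((hvd _ (hrefl x hx)).comp x (hsub x)).neg.congr_deriv
        (by rw [sphericalPotential_pi_sub]; ring))
      (fun x hx => by
        simpa using hmax' _ (Ioo_subset_Icc_self (hrefl x hx)))
      (by simpa using hvc)
      (by
        rw [intervalIntegral.integral_comp_sub_left (fun x => u x ^ 2) π]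
        simpa using hint)
    simpa using this

theorem sqrt_sin_mul_norm_sphericalHarmonic (ℓ : ℕ) (k : ℤ) {φ : ℝ} (hφ : φ ∈ Icc 0 π) (θ : ℝ) :
    sin φ ^ (1 / 2 : ℝ) * ‖sphericalHarmonic ℓ k φ θ‖ =
      (√(2 * π))⁻¹ * |weightedJacobi k.natAbs (ℓ - k.natAbs) φ| := by
  have hs := sin_nonneg_of_nonneg_of_le_pi hφ.1 hφ.2
  have he : ‖Complex.exp (Complex.I * k * θ)‖ = 1 := by
    have : Complex.I * k * θ = ((k * θ : ℝ) : ℂ) * Complex.I := by push_cast; ring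
    rw [this, Complex.norm_exp_ofReal_mul_I]
  have hp : sin φ ^ ((k.natAbs : ℝ) + 1 / 2) = sin φ ^ (1 / 2 : ℝ) * sin φ ^ k.natAbs := by
    rw [rpow_add_of_nonneg hs (by positivity) (by norm_num), rpow_natCast, mul_comm]
  rw [sphericalHarmonic, norm_mul, norm_mul, he, Complex.norm_real, Complex.norm_real,
    weightedJacobi, hp, norm_of_nonneg (by positivity : 0 ≤ (√(2 * π))⁻¹), Real.norm_eq_abs,
    abs_mul, abs_mul, abs_mul, abs_of_nonneg (rpow_nonneg hs _)]
  ring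

end Jacobi

theorem mainTheorem2 :
    ∃ C : ℝ, 0 < C ∧
      ∀ (ℓ : ℕ) (k : ℤ), -(ℓ : ℤ) ≤ k → k ≤ (ℓ : ℤ) →
        ∀ φ ∈ Set.Icc (0 : ℝ) Real.pi, ∀ θ ∈ Set.Ico (0 : ℝ) (2 * Real.pi),
          Real.sin φ ^ (1 / 2 : ℝ) * ‖sphericalHarmonic ℓ k φ θ‖
            ≤ C * ((ℓ : ℝ) + 1) ^ (1 / 4 : ℝ) := by
  -- `250² = 62500` exceeds `62400`.
  refine ⟨250, by norm_num, fun ℓ k hk1 hk2 φ hφ θ _ => ?_⟩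
  rw [sqrt_sin_mul_norm_sphericalHarmonic ℓ k hφ θ]
  have h1 := weightedJacobi_sq_le k.natAbs (ℓ - k.natAbs) hφ
  have hk : k.natAbs ≤ ℓ := by omega
  -- Here `n + α + 1/2` becomes `ℓ + 1/2`, so the bound no longer depends on `k`.
  rw [Nat.cast_sub hk, sub_add_cancel] at h1
  set y := ((ℓ : ℝ) + 1) ^ (1 / 4 : ℝ) with hy
  have hy0 : 0 ≤ y := by positivity
  have hy2 : y ^ 2 = √((ℓ : ℝ) + 1) := by
    rw [hy, ← Real.rpow_natCast, ← Real.rpow_mul (by positivity), Real.sqrt_eq_rpow]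
    norm_num
  have h2 : √((ℓ : ℝ) + 1 / 2) ≤ y ^ 2 := by
    rw [hy2]; exact Real.sqrt_le_sqrt (by linarith)
  have h3 : |weightedJacobi k.natAbs (ℓ - k.natAbs) φ| ≤ 250 * y :=
    abs_le_of_sq_le_sq (by rw [mul_pow]; nlinarith) (by positivity)
  have h4 : (√(2 * Real.pi))⁻¹ ≤ 1 :=
    inv_le_one_of_one_le₀ (Real.one_le_sqrt.2 (by linarith [Real.pi_gt_three]))
  calc _ ≤ 1 * |weightedJacobi k.natAbs (ℓ - k.natAbs) φ| := by gcongr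
    _ ≤ _ := by linarith
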